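/- Let $W(\mathrm dx,\mathrm dy)$ be a (Gaussian) white noise on the strip $\mathbb R\times[0,1]$ with Lebesgue intensity measure $\mu$, i.e. $(W(A))$, indexed by the Borel sets $A\subseteq\mathbb R\times[0,1]$ with $\mu(A)<\infty$, is a centered Gaussian process with $\operatorname{Cov}(W(A),W(B))=\mu(A\cap B)$. Put $$Z(u):=\frac{1}{(\log 2)^{1/2}}\int_{\mathbb R\times[0,1]}\Big(\mathbf 1_{\{y\le \exp(-e^{-(x-u)})\}}-\exp(-e^{-(x-u)})\Big)\,W(\mathrm dx,\mathrm dy),\qquad u\in\mathbb R,$$ where the integral is the $L^2$-stochastic integral with respect to $W$ (the $L^2$-limit of integrals of simple functions converging to the integrand in $L^2(\mu)$). These integrals exist, and $Z=(Z(u))_{u\in\mathbb R}$ is a stationary centered Gaussian process with covariance function $$\operatorname{Cov}(Z(u),Z(v))=\frac{\log(1+e^{-|u-v|})}{\log 2},\qquad u,v\in\mathbb R.$$ Furthermore, $Z$ has a version $Y$ (that is, $Y(u)=Z(u)$ almost surely for each $u\in\mathbb R$) all of whose sample paths are, for every $\alpha\in(0,1/2)$, Hölder continuous with exponent $\alpha$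 on every compact interval. -/

import Mathlib

open MeasureTheory ProbabilityTheory Filter Topology
open scoped NNReal ENNReal

noncomputable section

/-- `W` is a (Gaussian) white noise on `E` with intensity measure `μ`: the family of the `W A`,
over the measurable sets `A` with `μ A < ∞`, is a centered Gaussian process with
`Cov (W A, W B) = μ (A ∩ B)`. The values of `W` on other sets are irrelevant. -/
structure IsWhiteNoise {Ω E : Type*} [MeasurableSpace Ω] [MeasurableSpace E]
    (W : Set E → Ω → ℝ) (μ : Measure E) (P : Measure Ω) : Prop where
  isGaussianProcess :
    IsGaussianProcess (fun A : {A : Set E // MeasurableSet A ∧ μ A < ∞} ↦ W A) P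
  integral_eq_zero : ∀ A, MeasurableSet A → μ A < ∞ → ∫ ω, W A ω ∂P = 0
  covariance_eq : ∀ A B, MeasurableSet A → μ A < ∞ → MeasurableSet B → μ B < ∞ →
    cov[W A, W B; P] = μ.real (A ∩ B)

/-- The integral `∑ c, c * W {s = c}` of a simple function `s = ∑ c, c * 1_{s = c}`
against `W` (the term `c = 0` vanishes). -/
def simpleWhiteNoiseIntegral {Ω E : Type*} [MeasurableSpace E] (W : Set E → Ω → ℝ)
    (s : SimpleFunc E ℝ) (ω : Ω) : ℝ :=
  ∑ c ∈ s.range, c * W (s ⁻¹' {c}) ω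

/-- `X` is (a version of) the stochastic integral `∫ f dW`: the function `f` belongs to `L²(μ)`, and
`X` is the limit in `L²(P)` of integrals of square-integrable simple functions which converge
to `f` in `L²(μ)`. -/
def IsWhiteNoiseIntegral {Ω E : Type*} [MeasurableSpace Ω] [MeasurableSpace E]
    (W : Set E → Ω → ℝ) (μ : Measure E) (P : Measure Ω) (f : E → ℝ) (X : Ω → ℝ) : Prop :=
  MemLp f 2 μ ∧ MemLp X 2 P ∧
    ∃ s : ℕ → SimpleFunc E ℝ,
      (∀ n, MemLp (s n) 2 μ) ∧
      Tendsto (fun n ↦ eLpNorm (fun p ↦ s n p - f p) 2 μ) atTop (𝓝 0) ∧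
      Tendsto (fun n ↦ eLpNorm (fun ω ↦ simpleWhiteNoiseIntegral W (s n) ω - X ω) 2 P)
        atTop (𝓝 0)

/-- The stochastic integral `∫ f dW`, a random variable that is determined up to
almost sure equality. -/
def whiteNoiseIntegral {Ω E : Type*} [MeasurableSpace Ω] [MeasurableSpace E]
    (W : Set E → Ω → ℝ) (μ : Measure E) (P : Measure Ω) (f : E → ℝ) : Ω → ℝ :=
  Classical.epsilon (IsWhiteNoiseIntegral W μ P f)

/-- The integrand `1{y ≤ exp(-e^{-(x-u)})} - exp(-e^{-(x-u)})` on the strip `ℝ × [0,1]`. -/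
def gumbelKernel (u : ℝ) (p : ℝ × Set.Icc (0 : ℝ) 1) : ℝ :=
  Set.indicator {q : ℝ × Set.Icc (0 : ℝ) 1 | (q.2 : ℝ) ≤ Real.exp (-Real.exp (-(q.1 - u)))}
      (fun _ ↦ (1 : ℝ)) p
    - Real.exp (-Real.exp (-(p.1 - u)))

/-- The process `Z(u) = (log 2)^{-1/2} ∫ gumbelKernel u dW`, where the strip `ℝ × [0,1]` carries
Lebesgue measure. -/
def gumbelProcess {Ω : Type*} [MeasurableSpace Ω]
    (W : Set (ℝ × Set.Icc (0 : ℝ) 1) → Ω → ℝ) (P : Measure Ω) (u : ℝ) (ω : Ω) : ℝ :=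
  1 / √(Real.log 2) * whiteNoiseIntegral W volume P (gumbelKernel u) ω

/-- (Strict) stationarity: finite-dimensional distributions are invariant under time shifts. -/
def IsStationaryProcess {Ω : Type*} [MeasurableSpace Ω] (X : ℝ → Ω → ℝ) (P : Measure Ω) : Prop :=
  ∀ (h : ℝ) (I : Finset ℝ),
    IdentDistrib (fun ω (t : I) ↦ X (t + h) ω) (fun ω (t : I) ↦ X t ω) P P

end

/-! On simple functions the integral against `W` preserves inner products
(`IsWhiteNoise.covariance_simple`). It therefore extends to all of `L²`, and `L²`-limits keep
Gaussianity, means and covariances. The covariance of `Z` thus reduces to the inner product of two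
kernels.

Let `G` be the Gumbel distribution function. Integrating over `y` first leaves the covariance of two
indicators of a uniform variable, `min (G (x - u)) (G (x - v)) - G (x - u) * G (x - v)`. The minimum
is the translate of `G` by `max u v`, and by max-stability the product is the translate by `log (exp
u + exp v)`. The integral of a difference of translates is the difference of the shifts
(`integral_sub_translate`), here `log (1 + exp (-|u - v|))`. Since this depends only on `u - v`, the
Gaussian process is stationary.

The increments have variance at most `2 / log 2 * |u - v|`, so by Gaussian scaling their moments of
order `2q` are bounded by a multiple of `|u - v| ^ q` for every `q`. A Kolmogorov–Chentsov argument
along dyadic points then gives a version with every Hölder exponent below `1/2`. -/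

/-! ### Gaussianity under `L²` limits -/

section LTwoLimits

variable {α : Type*} [MeasurableSpace α] {ν : Measure α}

lemma inner_toLp_two_eq_integral_mul {f g : α → ℝ} (hf : MemLp f 2 ν) (hg : MemLp g 2 ν) :
    inner ℝ (hf.toLp f) (hg.toLp g) = ∫ x, f x * g x ∂ν := by
  rw [L2.inner_def]
  refine integral_congr_ae ?_
  filter_upwards [hf.coeFn_toLp, hg.coeFn_toLp] with x hx hy
  simp [hx, hy, mul_comm]

lemma tendsto_integral_mul_of_tendsto_eLpNorm_two {f g : α → ℝ} {u v : ℕ → α → ℝ}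
    (hf : MemLp f 2 ν) (hg : MemLp g 2 ν) (hu : ∀ n, MemLp (u n) 2 ν) (hv : ∀ n, MemLp (v n) 2 ν)
    (huf : Tendsto (fun n ↦ eLpNorm (u n - f) 2 ν) atTop (𝓝 0))
    (hvg : Tendsto (fun n ↦ eLpNorm (v n - g) 2 ν) atTop (𝓝 0)) :
    Tendsto (fun n ↦ ∫ x, u n x * v n x ∂ν) atTop (𝓝 (∫ x, f x * g x ∂ν)) := by
  have h1 := (Lp.tendsto_Lp_iff_tendsto_eLpNorm'' u hu f hf).2 huf
  have h2 := (Lp.tendsto_Lp_iff_tendsto_eLpNorm'' v hv g hg).2 hvg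
  have h := Filter.Tendsto.inner (𝕜 := ℝ) h1 h2
  simpa only [inner_toLp_two_eq_integral_mul] using h

variable [IsProbabilityMeasure ν]

lemma tendsto_integral_of_tendsto_eLpNorm_two {f : α → ℝ} {u : ℕ → α → ℝ}
    (hf : MemLp f 2 ν) (hu : ∀ n, MemLp (u n) 2 ν)
    (huf : Tendsto (fun n ↦ eLpNorm (u n - f) 2 ν) atTop (𝓝 0)) :
    Tendsto (fun n ↦ ∫ x, u n x ∂ν) atTop (𝓝 (∫ x, f x ∂ν)) := by
  simpa using tendsto_integral_mul_of_tendsto_eLpNorm_two hf (memLp_const 1) hu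
    (fun _ ↦ memLp_const (1 : ℝ)) huf (by simp)

lemma tendsto_covariance_of_tendsto_eLpNorm_two {f g : α → ℝ} {u v : ℕ → α → ℝ}
    (hf : MemLp f 2 ν) (hg : MemLp g 2 ν) (hu : ∀ n, MemLp (u n) 2 ν) (hv : ∀ n, MemLp (v n) 2 ν)
    (huf : Tendsto (fun n ↦ eLpNorm (u n - f) 2 ν) atTop (𝓝 0))
    (hvg : Tendsto (fun n ↦ eLpNorm (v n - g) 2 ν) atTop (𝓝 0)) :
    Tendsto (fun n ↦ cov[u n, v n; ν]) atTop (𝓝 cov[f, g; ν]) := by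
  simp_rw [fun n ↦ covariance_eq_sub (hu n) (hv n), covariance_eq_sub hf hg]
  exact (tendsto_integral_mul_of_tendsto_eLpNorm_two hf hg hu hv huf hvg).sub
    ((tendsto_integral_of_tendsto_eLpNorm_two hf hu huf).mul
      (tendsto_integral_of_tendsto_eLpNorm_two hg hv hvg))

/-- Limits in `L²` of Gaussian random variables are Gaussian. -/
lemma HasGaussianLaw.of_tendsto_eLpNorm_two {f : α → ℝ} {u : ℕ → α → ℝ}
    (hf : MemLp f 2 ν) (hu : ∀ n, HasGaussianLaw (u n) ν)
    (huf : Tendsto (fun n ↦ eLpNorm (u n - f) 2 ν) atTop (𝓝 0)) :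
    HasGaussianLaw f ν := by
  have hu2 : ∀ n, MemLp (u n) 2 ν := fun n ↦ (hu n).memLp_two
  have hmean := tendsto_integral_of_tendsto_eLpNorm_two hf hu2 huf
  have hvar := tendsto_covariance_of_tendsto_eLpNorm_two hf hf hu2 hu2 huf huf
  simp_rw [fun n ↦ covariance_self (hu n).aemeasurable, covariance_self hf.1.aemeasurable] at hvar
  -- Along an a.e. convergent subsequence the characteristic functions converge to that of `f` by
  -- dominated convergence, and to the Gaussian one because means and variances converge.
  obtain ⟨ns, hns, hae⟩ := (tendstoInMeasure_of_tendsto_eLpNorm two_ne_zero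
    (fun n ↦ (hu2 n).1) hf.1 huf).exists_seq_tendsto_ae
  suffices h : ν.map f = gaussianReal (∫ x, f x ∂ν) Var[f; ν].toNNReal by
    exact ⟨h ▸ inferInstance⟩
  have := Measure.isProbabilityMeasure_map hf.1.aemeasurable
  refine Measure.ext_of_charFun (funext fun t ↦ ?_)
  have key : ∀ {h : α → ℝ}, AEMeasurable h ν →
      charFun (ν.map h) t = ∫ x, Complex.exp (t * h x * Complex.I) ∂ν := fun {h} hh ↦ by
    rw [charFun_apply_real, integral_map hh (by fun_prop)]
  have hlim1 : Tendsto (fun k ↦ charFun (ν.map (u (ns k))) t) atTop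
      (𝓝 (charFun (ν.map f) t)) := by
    simp_rw [fun k ↦ key (hu (ns k)).aemeasurable, key hf.1.aemeasurable]
    refine tendsto_integral_of_dominated_convergence (fun _ ↦ 1) (fun k ↦ ?_)
      (integrable_const _) (fun k ↦ ae_of_all _ fun x ↦ ?_) ?_
    · have := (hu2 (ns k)).1
      fun_prop
    · rw [← Complex.ofReal_mul, Complex.norm_exp_ofReal_mul_I]
    · filter_upwards [hae] with x hx
      have : Continuous fun y : ℝ ↦ Complex.exp (t * y * Complex.I) := by fun_prop
      exact (this.tendsto _).comp hx
  have hlim2 : Tendsto (fun k ↦ charFun (ν.map (u (ns k))) t) atTop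
      (𝓝 (charFun (gaussianReal (∫ x, f x ∂ν) Var[f; ν].toNNReal) t)) := by
    simp_rw [fun k ↦ (hu (ns k)).map_eq_gaussianReal, charFun_gaussianReal,
      Real.coe_toNNReal _ (variance_nonneg _ _)]
    have h1 : Tendsto (fun k ↦ ((∫ x, u (ns k) x ∂ν : ℝ) : ℂ)) atTop (𝓝 (∫ x, f x ∂ν : ℝ)) :=
      (Complex.continuous_ofReal.tendsto _).comp (hmean.comp hns.tendsto_atTop)
    have h2 : Tendsto (fun k ↦ (Var[u (ns k); ν] : ℂ)) atTop (𝓝 (Var[f; ν] : ℂ)) :=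
      (Complex.continuous_ofReal.tendsto _).comp (hvar.comp hns.tendsto_atTop)
    exact Tendsto.cexp (((h1.const_mul (t : ℂ)).mul_const Complex.I).sub
      ((h2.mul_const ((t : ℂ) ^ 2)).div_const 2))
  exact tendsto_nhds_unique hlim1 hlim2

omit [IsProbabilityMeasure ν] in
lemma hasGaussianLaw_of_forall_clm {E : Type*} [NormedAddCommGroup E] [NormedSpace ℝ E]
    [MeasurableSpace E] [BorelSpace E] {X : α → E} (hX : AEMeasurable X ν)
    (h : ∀ L : E →L[ℝ] ℝ, HasGaussianLaw (fun ω ↦ L (X ω)) ν) : HasGaussianLaw X ν := by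
  refine ⟨isGaussian_of_map_eq_gaussianReal fun L ↦ ?_⟩
  rw [AEMeasurable.map_map_of_aemeasurable (by fun_prop) hX]
  exact ⟨_, _, (h L).map_eq_gaussianReal⟩

lemma ContinuousLinearMap.apply_pi_eq_sum {ι : Type*} [Fintype ι] [DecidableEq ι]
    (L : (ι → ℝ) →L[ℝ] ℝ) (x : ι → ℝ) :
    L x = ∑ i, L (Pi.single i 1) * x i := by
  conv_lhs => rw [← Finset.univ_sum_single x, map_sum]
  refine Finset.sum_congr rfl fun i _ ↦ ?_
  have : (Pi.single i (x i) : ι → ℝ) = x i • Pi.single i 1 := by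
    rw [← Pi.single_smul]; simp
  rw [this, map_smul, smul_eq_mul, mul_comm]

/-- Limits in `L²` of Gaussian processes are Gaussian processes. -/
lemma IsGaussianProcess.of_tendsto_eLpNorm_two {T : Type*} {Y : T → α → ℝ} {X : ℕ → T → α → ℝ}
    (hY : ∀ t, MemLp (Y t) 2 ν) (hX : ∀ n, IsGaussianProcess (X n) ν)
    (hXY : ∀ t, Tendsto (fun n ↦ eLpNorm (X n t - Y t) 2 ν) atTop (𝓝 0)) :
    IsGaussianProcess Y ν := by
  classical
  refine ⟨fun I ↦ hasGaussianLaw_of_forall_clm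
    (aemeasurable_pi_lambda _ fun i ↦ (hY i).1.aemeasurable) fun L ↦ ?_⟩
  have hX2 : ∀ n t, MemLp (X n t) 2 ν := fun n t ↦ ((hX n).hasGaussianLaw_eval t).memLp_two
  refine HasGaussianLaw.of_tendsto_eLpNorm_two
    (u := fun n ω ↦ L (I.restrict (X n · ω))) ?_
    (fun n ↦ ((hX n).hasGaussianLaw I).map_fun L) ?_
  · rw [show (fun ω ↦ L (I.restrict (Y · ω))) = fun ω ↦ ∑ i : I, L (Pi.single i 1) * Y i ω from
      funext fun ω ↦ L.apply_pi_eq_sum _]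
    exact memLp_finsetSum _ fun i _ ↦ (hY i).const_mul _
  · have hle : ∀ n, eLpNorm ((fun ω ↦ L (I.restrict (X n · ω)))
        - fun ω ↦ L (I.restrict (Y · ω))) 2 ν
        ≤ ∑ i : I, ‖L (Pi.single i 1)‖ₑ * eLpNorm (X n i - Y i) 2 ν := fun n ↦ by
      have : ((fun ω ↦ L (I.restrict (X n · ω))) - fun ω ↦ L (I.restrict (Y · ω)))
          = ∑ i : I, L (Pi.single i 1) • (X n i - Y i) := by
        ext ω
        rw [Pi.sub_apply, ← map_sub, L.apply_pi_eq_sum, Finset.sum_apply]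
        rfl
      rw [this]
      refine (eLpNorm_sum_le (fun i _ ↦ ?_) (by norm_num)).trans_eq ?_
      · exact (((hX2 n i).sub (hY i)).const_smul _).1
      · simp_rw [eLpNorm_const_smul]
    refine tendsto_of_tendsto_of_tendsto_of_le_of_le tendsto_const_nhds ?_
      (fun _ ↦ zero_le) hle
    rw [show (0 : ℝ≥0∞) = ∑ i : I, ‖L (Pi.single i 1)‖ₑ * 0 by simp]
    exact tendsto_finsetSum _ fun i _ ↦
      ENNReal.Tendsto.const_mul (hXY i) (.inr enorm_ne_top)

end LTwoLimits

/-! ### The stochastic integral and its isometry -/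

section WhiteNoise

variable {Ω E : Type*} [MeasurableSpace Ω] [MeasurableSpace E]
  {W : Set E → Ω → ℝ} {μ : Measure E} {P : Measure Ω} [IsProbabilityMeasure P]

omit [IsProbabilityMeasure P] in
lemma IsWhiteNoise.memLp (hW : IsWhiteNoise W μ P) {A : Set E} (hA : MeasurableSet A)
    (hA' : μ A < ∞) : MemLp (W A) 2 P :=
  (hW.isGaussianProcess.hasGaussianLaw_eval ⟨A, hA, hA'⟩).memLp_two

omit [IsProbabilityMeasure P] in
-- The fibre over `0` may have infinite measure, where nothing is known about `W`; the factor `c =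
-- 0` removes that term. All other fibres have finite measure.
lemma IsWhiteNoise.memLp_const_mul_preimage (hW : IsWhiteNoise W μ P) {s : SimpleFunc E ℝ}
    (hs : MemLp s 2 μ) (c : ℝ) : MemLp (fun ω ↦ c * W (s ⁻¹' {c}) ω) 2 P := by
  rcases eq_or_ne c 0 with rfl | hc
  · simp
  · exact (hW.memLp (s.measurableSet_fiber c)
      (s.measure_preimage_lt_top_of_memLp two_ne_zero (by simp) hs c hc)).const_mul c

omit [IsProbabilityMeasure P] in
lemma IsWhiteNoise.memLp_simple (hW : IsWhiteNoise W μ P) {s : SimpleFunc E ℝ}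
    (hs : MemLp s 2 μ) : MemLp (simpleWhiteNoiseIntegral W s) 2 P :=
  memLp_finsetSum _ fun c _ ↦ hW.memLp_const_mul_preimage hs c

lemma IsWhiteNoise.integral_simple (hW : IsWhiteNoise W μ P) {s : SimpleFunc E ℝ}
    (hs : MemLp s 2 μ) : ∫ ω, simpleWhiteNoiseIntegral W s ω ∂P = 0 := by
  unfold simpleWhiteNoiseIntegral
  rw [integral_finsetSum _ fun c _ ↦
    (hW.memLp_const_mul_preimage hs c).integrable one_le_two]
  refine Finset.sum_eq_zero fun c _ ↦ ?_
  rcases eq_or_ne c 0 with rfl | hc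
  · simp
  · rw [integral_const_mul, hW.integral_eq_zero _ (s.measurableSet_fiber c)
      (s.measure_preimage_lt_top_of_memLp two_ne_zero (by simp) hs c hc), mul_zero]

lemma SimpleFunc.integral_mul_eq_sum {s t : SimpleFunc E ℝ} (hs : MemLp s 2 μ) :
    ∫ x, s x * t x ∂μ
      = ∑ c ∈ s.range, ∑ d ∈ t.range, c * d * μ.real (s ⁻¹' {c} ∩ t ⁻¹' {d}) := by
  have hpt : ∀ x, s x * t x = ∑ c ∈ s.range, ∑ d ∈ t.range,
      (s ⁻¹' {c} ∩ t ⁻¹' {d}).indicator (fun _ ↦ c * d) x := fun x ↦ by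
    rw [Finset.sum_eq_single_of_mem (s x) (s.mem_range_self x),
      Finset.sum_eq_single_of_mem (t x) (t.mem_range_self x)]
    · simp
    · intro d _ hd
      exact Set.indicator_of_notMem (fun h ↦ hd h.2.symm) _
    · intro c _ hc
      exact Finset.sum_eq_zero fun d _ ↦ Set.indicator_of_notMem (fun h ↦ hc h.1.symm) _
  have hint : ∀ c d, Integrable ((s ⁻¹' {c} ∩ t ⁻¹' {d}).indicator (fun _ ↦ c * d)) μ := by
    intro c d
    rcases eq_or_ne c 0 with rfl | hc
    · simp
    · refine (integrable_indicator_iff ((s.measurableSet_fiber c).inter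
        (t.measurableSet_fiber d))).2 (integrableOn_const ?_)
      exact ((measure_mono Set.inter_subset_left).trans_lt
        (s.measure_preimage_lt_top_of_memLp two_ne_zero (by simp) hs c hc)).ne
  simp_rw [hpt]
  rw [integral_finsetSum _ fun c _ ↦ integrable_finsetSum _ fun d _ ↦ hint c d]
  refine Finset.sum_congr rfl fun c _ ↦ ?_
  rw [integral_finsetSum _ fun d _ ↦ hint c d]
  refine Finset.sum_congr rfl fun d _ ↦ ?_
  rw [integral_indicator_const _ ((s.measurableSet_fiber c).inter (t.measurableSet_fiber d)),
    smul_eq_mul, mul_comm]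

/-- The Itô isometry for simple functions, in polarized form. -/
lemma IsWhiteNoise.covariance_simple (hW : IsWhiteNoise W μ P) {s t : SimpleFunc E ℝ}
    (hs : MemLp s 2 μ) (ht : MemLp t 2 μ) :
    cov[simpleWhiteNoiseIntegral W s, simpleWhiteNoiseIntegral W t; P]
      = ∫ x, s x * t x ∂μ := by
  rw [SimpleFunc.integral_mul_eq_sum hs]
  unfold simpleWhiteNoiseIntegral
  rw [covariance_fun_sum_fun_sum' (fun c _ ↦ hW.memLp_const_mul_preimage hs c)
    (fun d _ ↦ hW.memLp_const_mul_preimage ht d)]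
  refine Finset.sum_congr rfl fun c _ ↦ Finset.sum_congr rfl fun d _ ↦ ?_
  rw [covariance_const_mul_left, covariance_const_mul_right]
  rcases eq_or_ne c 0 with rfl | hc
  · simp
  rcases eq_or_ne d 0 with rfl | hd
  · simp
  rw [hW.covariance_eq _ _ (s.measurableSet_fiber c)
    (s.measure_preimage_lt_top_of_memLp two_ne_zero (by simp) hs c hc) (t.measurableSet_fiber d)
    (t.measure_preimage_lt_top_of_memLp two_ne_zero (by simp) ht d hd), mul_assoc]

lemma IsWhiteNoise.inner_simple (hW : IsWhiteNoise W μ P) {s t : SimpleFunc E ℝ}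
    (hs : MemLp s 2 μ) (ht : MemLp t 2 μ) :
    inner ℝ ((hW.memLp_simple hs).toLp _) ((hW.memLp_simple ht).toLp _)
      = inner ℝ (hs.toLp s) (ht.toLp t) := by
  rw [inner_toLp_two_eq_integral_mul, inner_toLp_two_eq_integral_mul,
    ← hW.covariance_simple hs ht, covariance_eq_sub (hW.memLp_simple hs) (hW.memLp_simple ht),
    hW.integral_simple hs]
  simp

/-- Expanding the squared norm of the difference into inner products avoids proving that the
integral is additive on simple functions. -/
lemma IsWhiteNoise.dist_simple (hW : IsWhiteNoise W μ P) {s t : SimpleFunc E ℝ}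
    (hs : MemLp s 2 μ) (ht : MemLp t 2 μ) :
    dist ((hW.memLp_simple hs).toLp _) ((hW.memLp_simple ht).toLp _)
      = dist (hs.toLp s) (ht.toLp t) := by
  rw [dist_eq_norm, dist_eq_norm, ← sq_eq_sq₀ (norm_nonneg _) (norm_nonneg _),
    norm_sub_sq_real, norm_sub_sq_real, ← real_inner_self_eq_norm_sq,
    ← real_inner_self_eq_norm_sq, ← real_inner_self_eq_norm_sq, ← real_inner_self_eq_norm_sq]
  rw [hW.inner_simple hs ht, hW.inner_simple hs hs, hW.inner_simple ht ht]

/-- Every function in `L²(μ)` has a stochastic integral. -/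
lemma IsWhiteNoise.exists_isWhiteNoiseIntegral (hW : IsWhiteNoise W μ P) {f : E → ℝ}
    (hf : MemLp f 2 μ) : ∃ X, IsWhiteNoiseIntegral W μ P f X := by
  have hex : ∀ n : ℕ, ∃ s : SimpleFunc E ℝ,
      eLpNorm (f - ⇑s) 2 μ < (n + 1 : ℝ≥0∞)⁻¹ ∧ MemLp s 2 μ :=
    fun n ↦ hf.exists_simpleFunc_eLpNorm_sub_lt (by simp) (by simp)
  choose s hs hs2 using hex
  have hsf : Tendsto (fun n ↦ eLpNorm (⇑(s n) - f) 2 μ) atTop (𝓝 0) := by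
    refine tendsto_of_tendsto_of_tendsto_of_le_of_le tendsto_const_nhds
      (h := fun n : ℕ ↦ (n + 1 : ℝ≥0∞)⁻¹) ?_ (fun _ ↦ zero_le) fun n ↦ ?_
    · exact_mod_cast (tendsto_add_atTop_iff_nat 1).2 ENNReal.tendsto_inv_nat_nhds_zero
    · rw [eLpNorm_sub_comm]
      exact (hs n).le
  have hlim := (Lp.tendsto_Lp_iff_tendsto_eLpNorm'' (fun n ↦ ⇑(s n)) hs2 f hf).2 hsf
  -- The isometry transfers the Cauchy property from the simple functions to their integrals.
  have hC : CauchySeq fun n ↦ (hW.memLp_simple (hs2 n)).toLp _ := by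
    have := hlim.cauchySeq
    rw [Metric.cauchySeq_iff] at this ⊢
    intro ε hε
    obtain ⟨N, hN⟩ := this ε hε
    exact ⟨N, fun m hm n hn ↦ (hW.dist_simple (hs2 m) (hs2 n)).trans_lt (hN m hm n hn)⟩
  obtain ⟨X, hX⟩ := cauchySeq_tendsto_of_complete hC
  refine ⟨X, hf, Lp.memLp X, s, hs2, hsf, ?_⟩
  have hX' : (Lp.memLp X).toLp X = X := Lp.toLp_coeFn X (Lp.memLp X)
  rw [← hX'] at hX
  exact (Lp.tendsto_Lp_iff_tendsto_eLpNorm'' _ (fun n ↦ hW.memLp_simple (hs2 n)) _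
    (Lp.memLp X)).1 hX

lemma IsWhiteNoise.isWhiteNoiseIntegral (hW : IsWhiteNoise W μ P) {f : E → ℝ}
    (hf : MemLp f 2 μ) : IsWhiteNoiseIntegral W μ P f (whiteNoiseIntegral W μ P f) :=
  Classical.epsilon_spec (hW.exists_isWhiteNoiseIntegral hf)

lemma IsWhiteNoiseIntegral.integral_eq_zero {f : E → ℝ} {X : Ω → ℝ}
    (h : IsWhiteNoiseIntegral W μ P f X) (hW : IsWhiteNoise W μ P) : ∫ ω, X ω ∂P = 0 := by
  obtain ⟨-, hX, s, hs, -, hsX⟩ := h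
  refine tendsto_nhds_unique
    (tendsto_integral_of_tendsto_eLpNorm_two hX (fun n ↦ hW.memLp_simple (hs n)) hsX) ?_
  simp_rw [fun n ↦ hW.integral_simple (hs n)]
  exact tendsto_const_nhds

/-- The Itô isometry, in polarized form. -/
lemma IsWhiteNoiseIntegral.covariance_eq {f g : E → ℝ} {X Y : Ω → ℝ}
    (hX : IsWhiteNoiseIntegral W μ P f X) (hY : IsWhiteNoiseIntegral W μ P g Y)
    (hW : IsWhiteNoise W μ P) : cov[X, Y; P] = ∫ x, f x * g x ∂μ := by
  obtain ⟨hf, hX, s, hs, hsf, hsX⟩ := hX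
  obtain ⟨hg, hY, t, ht, htg, htY⟩ := hY
  refine tendsto_nhds_unique
    (tendsto_covariance_of_tendsto_eLpNorm_two hX hY (fun n ↦ hW.memLp_simple (hs n))
      (fun n ↦ hW.memLp_simple (ht n)) hsX htY) ?_
  simp_rw [fun n ↦ hW.covariance_simple (hs n) (ht n)]
  exact tendsto_integral_mul_of_tendsto_eLpNorm_two hf hg hs ht hsf htg

omit [IsProbabilityMeasure P] in
-- Each integral is a linear functional of finitely many coordinates of `W`. The value `0` is erased
-- from the range because its fibre need not be an admissible index.
lemma IsWhiteNoise.isGaussianProcess_simple (hW : IsWhiteNoise W μ P) {T : Type*}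
    {s : T → SimpleFunc E ℝ} (hs : ∀ t, MemLp (s t) 2 μ) :
    IsGaussianProcess (fun t ↦ simpleWhiteNoiseIntegral W (s t)) P := by
  classical
  have hfin : ∀ t, ∀ c ∈ (s t).range.erase 0, μ (s t ⁻¹' {c}) < ∞ := fun t c hc ↦
    (s t).measure_preimage_lt_top_of_memLp two_ne_zero (by simp) (hs t) c
      (Finset.ne_of_mem_erase hc)
  refine hW.isGaussianProcess.of_isGaussianProcess fun t ↦ ?_
  let J (c : (s t).range.erase 0) : {A : Set E // MeasurableSet A ∧ μ A < ∞} :=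
    ⟨s t ⁻¹' {c.1}, (s t).measurableSet_fiber c.1, hfin t c.1 c.2⟩
  refine ⟨Finset.univ.image J,
    ∑ c : (s t).range.erase 0, c.1 • ContinuousLinearMap.proj (R := ℝ) ⟨J c, by simp⟩, fun ω ↦ ?_⟩
  simp only [simpleWhiteNoiseIntegral, FunLike.coe_sum, Finset.sum_apply,
    FunLike.coe_smul, Pi.smul_apply, ContinuousLinearMap.proj_apply,
    Finset.restrict, smul_eq_mul, J]
  rw [← Finset.sum_erase (a := (0 : ℝ)) _ (by simp)]
  exact (Finset.sum_coe_sort ((s t).range.erase 0) fun c ↦ c * W (s t ⁻¹' {c}) ω).symm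

/-- Stochastic integrals form a Gaussian process. -/
lemma IsWhiteNoise.isGaussianProcess_integral (hW : IsWhiteNoise W μ P) {T : Type*}
    {f : T → E → ℝ} {X : T → Ω → ℝ} (h : ∀ t, IsWhiteNoiseIntegral W μ P (f t) (X t)) :
    IsGaussianProcess X P := by
  choose hf hX s hs hsf hsX using h
  exact IsGaussianProcess.of_tendsto_eLpNorm_two hX
    (fun n ↦ hW.isGaussianProcess_simple fun t ↦ hs t n) hsX

end WhiteNoise

/-! ### Integrals of differences of translates -/

section TranslateDifference

variable {F : ℝ → ℝ} {a b m n : ℝ}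

/-- An explicit antiderivative of the difference of translates, available for merely continuous `F`;
its limits at both ends then give the integral over the line. -/
lemma hasDerivAt_integral_translate (hF : Continuous F) (a b x : ℝ) :
    HasDerivAt (fun x ↦ ∫ s in -a..-b, F (x + s)) (F (x - b) - F (x - a)) x := by
  have hΦ : ∀ y, HasDerivAt (fun u ↦ ∫ s in (0 : ℝ)..u, F s) (F y) y := fun y ↦
    intervalIntegral.integral_hasDerivAt_right (hF.intervalIntegrable _ _)
      hF.aestronglyMeasurable.stronglyMeasurableAtFilter hF.continuousAt
  have heq : (fun x ↦ ∫ s in -a..-b, F (x + s))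
      = fun x ↦ (∫ s in (0 : ℝ)..(x - b), F s) - ∫ s in (0 : ℝ)..(x - a), F s := by
    ext y
    rw [intervalIntegral.integral_comp_add_left, intervalIntegral.integral_interval_sub_left
      (hF.intervalIntegrable _ _) (hF.intervalIntegrable _ _), ← sub_eq_add_neg, ← sub_eq_add_neg]
  rw [heq]
  exact ((hΦ (x - b)).comp_sub_const x b).sub ((hΦ (x - a)).comp_sub_const x a)

lemma tendsto_integral_translate {l l' : Filter ℝ} [l.IsCountablyGenerated] {c : ℝ}
    (hF : Continuous F) {C : ℝ} (hC : ∀ x, |F x| ≤ C) (hl : Tendsto F l' (𝓝 c))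
    (hll : ∀ s, Tendsto (fun x : ℝ ↦ x + s) l l') (a b : ℝ) :
    Tendsto (fun x ↦ ∫ s in -a..-b, F (x + s)) l (𝓝 ((a - b) * c)) := by
  have : ∫ _ in -a..-b, c = (a - b) * c := by
    rw [intervalIntegral.integral_const, smul_eq_mul]; ring
  rw [← this]
  refine intervalIntegral.tendsto_integral_filter_of_dominated_convergence (fun _ ↦ C)
    (.of_forall fun x ↦ ?_) (.of_forall fun x ↦ ae_of_all _ fun s _ ↦ hC _)
    intervalIntegrable_const (ae_of_all _ fun s _ ↦ hl.comp (hll s))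
  exact Continuous.aestronglyMeasurable (by fun_prop)

lemma integrable_sub_translate (hF : Continuous F) (hmono : Monotone F) {C : ℝ}
    (hC : ∀ x, |F x| ≤ C) (hbot : Tendsto F atBot (𝓝 m)) (htop : Tendsto F atTop (𝓝 n))
    (hba : b ≤ a) : Integrable fun x ↦ F (x - b) - F (x - a) := by
  have hcont : Continuous fun x ↦ F (x - b) - F (x - a) := by fun_prop
  refine integrable_of_intervalIntegral_norm_tendsto (l := atTop) (a := fun r : ℝ ↦ -r) (b := id)
    ((a - b) * n - (a - b) * m)
    (fun r ↦ hcont.integrableOn_Ioc) tendsto_neg_atTop_atBot tendsto_id ?_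
  -- By monotonicity the integrand is nonnegative, so the integral of its norm is an increment of
  -- the antiderivative.
  have h1 : ∀ r : ℝ, ∫ x in -r..r, ‖F (x - b) - F (x - a)‖
      = (∫ s in -a..-b, F (r + s)) - ∫ s in -a..-b, F (-r + s) := fun r ↦ by
    rw [← intervalIntegral.integral_eq_sub_of_hasDerivAt
      (fun x _ ↦ hasDerivAt_integral_translate hF a b x) (hcont.intervalIntegrable _ _)]
    refine intervalIntegral.integral_congr fun x _ ↦ ?_
    exact Real.norm_of_nonneg (sub_nonneg.2 (hmono (by linarith)))
  simp only [id, h1]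
  exact (tendsto_integral_translate hF hC htop
      (fun s ↦ tendsto_atTop_add_const_right _ s tendsto_id) a b).sub
    ((tendsto_integral_translate hF hC hbot
      (fun s ↦ tendsto_atBot_add_const_right _ s tendsto_id) a b).comp tendsto_neg_atTop_atBot)

/-- The integral of the difference of two translates of a distribution function. -/
lemma integral_sub_translate (hF : Continuous F) (hmono : Monotone F) {C : ℝ}
    (hC : ∀ x, |F x| ≤ C) (hbot : Tendsto F atBot (𝓝 m)) (htop : Tendsto F atTop (𝓝 n))
    (hba : b ≤ a) : ∫ x, (F (x - b) - F (x - a)) = (a - b) * (n - m) := by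
  rw [integral_of_hasDerivAt_of_tendsto (hasDerivAt_integral_translate hF a b)
    (integrable_sub_translate hF hmono hC hbot htop hba)
    (tendsto_integral_translate hF hC hbot
      (fun s ↦ tendsto_atBot_add_const_right _ s tendsto_id) a b)
    (tendsto_integral_translate hF hC htop
      (fun s ↦ tendsto_atTop_add_const_right _ s tendsto_id) a b), mul_sub]

end TranslateDifference

/-! ### The Gumbel distribution and the kernel -/

/-- The distribution function of the standard Gumbel law. -/
noncomputable def gumbelCDF (x : ℝ) : ℝ := Real.exp (-Real.exp (-x))

lemma continuous_gumbelCDF : Continuous gumbelCDF := by unfold gumbelCDF; fun_prop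

lemma monotone_gumbelCDF : Monotone gumbelCDF := fun x y h ↦ by
  unfold gumbelCDF; gcongr

lemma gumbelCDF_pos (x : ℝ) : 0 < gumbelCDF x := Real.exp_pos _

lemma gumbelCDF_le_one (x : ℝ) : gumbelCDF x ≤ 1 :=
  Real.exp_le_one_iff.2 (neg_nonpos.2 (Real.exp_pos _).le)

lemma abs_gumbelCDF_le_one (x : ℝ) : |gumbelCDF x| ≤ 1 := by
  rw [abs_of_pos (gumbelCDF_pos x)]; exact gumbelCDF_le_one x

lemma tendsto_gumbelCDF_atBot : Tendsto gumbelCDF atBot (𝓝 0) :=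
  Real.tendsto_exp_atBot.comp (tendsto_neg_atTop_atBot.comp
    (Real.tendsto_exp_atTop.comp tendsto_neg_atBot_atTop))

lemma tendsto_gumbelCDF_atTop : Tendsto gumbelCDF atTop (𝓝 1) := by
  have h : Tendsto (fun x : ℝ ↦ -Real.exp (-x)) atTop (𝓝 0) := by
    simpa using (Real.tendsto_exp_atBot.comp tendsto_neg_atTop_atBot).neg
  rw [← Real.exp_zero]
  exact (Real.continuous_exp.tendsto 0).comp h

/-- Max-stability: `exp (-(x - u)) + exp (-(x - v)) = exp (-x) * (exp u + exp v)`. -/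
lemma gumbelCDF_mul (u v x : ℝ) : gumbelCDF (x - u) * gumbelCDF (x - v)
    = gumbelCDF (x - Real.log (Real.exp u + Real.exp v)) := by
  unfold gumbelCDF
  rw [← Real.exp_add]
  congr 1
  rw [neg_sub, neg_sub, neg_sub, Real.exp_sub, Real.exp_sub, Real.exp_sub, Real.exp_log
    (by positivity)]
  ring

lemma max_le_log_exp_add_exp (u v : ℝ) : max u v ≤ Real.log (Real.exp u + Real.exp v) := by
  refine max_le ?_ ?_ <;> rw [Real.le_log_iff_exp_le (by positivity)]
  · linarith [Real.exp_pos v]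
  · linarith [Real.exp_pos u]

lemma log_exp_add_exp_sub_max (u v : ℝ) :
    Real.log (Real.exp u + Real.exp v) - max u v = Real.log (1 + Real.exp (-|u - v|)) := by
  wlog h : v ≤ u generalizing u v
  · rw [add_comm, max_comm, abs_sub_comm]
    exact this v u (le_of_not_ge h)
  rw [max_eq_left h, abs_of_nonneg (sub_nonneg.2 h), neg_sub, Real.exp_sub]
  nth_rewrite 2 [← Real.log_exp u]
  rw [← Real.log_div (by positivity) (by positivity), add_div, div_self (Real.exp_pos u).ne']

lemma min_gumbelCDF_sub_mul (u v x : ℝ) :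
    min (gumbelCDF (x - u)) (gumbelCDF (x - v)) - gumbelCDF (x - u) * gumbelCDF (x - v)
      = gumbelCDF (x - max u v) - gumbelCDF (x - Real.log (Real.exp u + Real.exp v)) := by
  rw [gumbelCDF_mul, ← monotone_gumbelCDF.map_min, min_sub_sub_left]

lemma integrable_min_gumbelCDF_sub_mul (u v : ℝ) : Integrable fun x ↦
    min (gumbelCDF (x - u)) (gumbelCDF (x - v)) - gumbelCDF (x - u) * gumbelCDF (x - v) := by
  simp_rw [min_gumbelCDF_sub_mul]
  exact integrable_sub_translate continuous_gumbelCDF monotone_gumbelCDF abs_gumbelCDF_le_one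
    tendsto_gumbelCDF_atBot tendsto_gumbelCDF_atTop (max_le_log_exp_add_exp u v)

lemma integral_min_gumbelCDF_sub_mul (u v : ℝ) :
    ∫ x, (min (gumbelCDF (x - u)) (gumbelCDF (x - v)) - gumbelCDF (x - u) * gumbelCDF (x - v))
      = Real.log (1 + Real.exp (-|u - v|)) := by
  simp_rw [min_gumbelCDF_sub_mul]
  rw [integral_sub_translate continuous_gumbelCDF monotone_gumbelCDF abs_gumbelCDF_le_one
    tendsto_gumbelCDF_atBot tendsto_gumbelCDF_atTop (max_le_log_exp_add_exp u v),
    log_exp_add_exp_sub_max, sub_zero, mul_one]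

/-- The covariance of the indicators of two events `{U ≤ a}`, `{U ≤ b}` with `U` uniform. -/
lemma integral_indicator_Iic_sub_mul (a b : Set.Icc (0 : ℝ) 1) :
    ∫ y : Set.Icc (0 : ℝ) 1, ((Set.Iic a).indicator (fun _ ↦ (1 : ℝ)) y - a)
      * ((Set.Iic b).indicator (fun _ ↦ (1 : ℝ)) y - b) = min (a : ℝ) b - a * b := by
  have hvol : ∀ c : Set.Icc (0 : ℝ) 1, volume.real (Set.Iic c) = c := fun c ↦ by
    rw [Measure.real, unitInterval.volume_Iic, ENNReal.toReal_ofReal c.2.1]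
  have hint : ∀ c : Set.Icc (0 : ℝ) 1,
      Integrable ((Set.Iic c).indicator (fun _ ↦ (1 : ℝ))) volume := fun c ↦
    (integrable_const _).indicator measurableSet_Iic
  have hI : ∀ c : Set.Icc (0 : ℝ) 1,
      ∫ y, (Set.Iic c).indicator (fun _ ↦ (1 : ℝ)) y = c := fun c ↦ by
    rw [integral_indicator_const _ measurableSet_Iic, hvol]; simp
  have hpt : ∀ y : Set.Icc (0 : ℝ) 1, ((Set.Iic a).indicator (fun _ ↦ (1 : ℝ)) y - a)
      * ((Set.Iic b).indicator (fun _ ↦ (1 : ℝ)) y - b)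
      = (Set.Iic (min a b)).indicator (fun _ ↦ (1 : ℝ)) y
        - b * (Set.Iic a).indicator (fun _ ↦ (1 : ℝ)) y
        - a * (Set.Iic b).indicator (fun _ ↦ (1 : ℝ)) y + a * b := fun y ↦ by
    by_cases h1 : y ≤ a <;> by_cases h2 : y ≤ b <;> simp [h1, h2] <;> ring
  simp_rw [hpt]
  have hsub : Integrable (fun y ↦ (Set.Iic (min a b)).indicator (fun _ ↦ (1 : ℝ)) y
      - b * (Set.Iic a).indicator (fun _ ↦ (1 : ℝ)) y) volume :=
    (hint _).sub ((hint _).const_mul _)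
  have hsub' : Integrable (fun y ↦ (Set.Iic (min a b)).indicator (fun _ ↦ (1 : ℝ)) y
      - b * (Set.Iic a).indicator (fun _ ↦ (1 : ℝ)) y
      - a * (Set.Iic b).indicator (fun _ ↦ (1 : ℝ)) y) volume :=
    hsub.sub ((hint _).const_mul _)
  rw [integral_add hsub' (integrable_const _), integral_sub hsub ((hint _).const_mul _),
    integral_sub (hint _) ((hint _).const_mul _), integral_const_mul, integral_const_mul, hI, hI,
    hI, integral_const]
  have hmin : ((min a b : Set.Icc (0 : ℝ) 1) : ℝ) = min (a : ℝ) b :=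
    (Subtype.mono_coe _).map_min
  rw [hmin]
  simp
  ring

lemma gumbelKernel_apply (u x : ℝ) (y : Set.Icc (0 : ℝ) 1) :
    gumbelKernel u (x, y)
      = (Set.Iic (⟨gumbelCDF (x - u), (gumbelCDF_pos _).le, gumbelCDF_le_one _⟩ :
          Set.Icc (0 : ℝ) 1)).indicator (fun _ ↦ (1 : ℝ)) y - gumbelCDF (x - u) := rfl

lemma measurable_gumbelKernel (u : ℝ) : Measurable (gumbelKernel u) := by
  unfold gumbelKernel
  refine (measurable_const.indicator (measurableSet_le ?_ ?_)).sub ?_ <;> fun_prop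

lemma integral_gumbelKernel_mul_snd (u v x : ℝ) :
    ∫ y, gumbelKernel u (x, y) * gumbelKernel v (x, y)
      = min (gumbelCDF (x - u)) (gumbelCDF (x - v)) - gumbelCDF (x - u) * gumbelCDF (x - v) :=
  integral_indicator_Iic_sub_mul ⟨gumbelCDF (x - u), (gumbelCDF_pos _).le, gumbelCDF_le_one _⟩
    ⟨gumbelCDF (x - v), (gumbelCDF_pos _).le, gumbelCDF_le_one _⟩

lemma abs_gumbelKernel_le (u : ℝ) (p : ℝ × Set.Icc (0 : ℝ) 1) : |gumbelKernel u p| ≤ 1 := by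
  obtain ⟨x, y⟩ := p
  have h0 := gumbelCDF_pos (x - u)
  have h1 := gumbelCDF_le_one (x - u)
  rw [gumbelKernel_apply, abs_le]
  by_cases h : y ∈ Set.Iic (⟨gumbelCDF (x - u), (gumbelCDF_pos _).le, gumbelCDF_le_one _⟩ :
          Set.Icc (0 : ℝ) 1) <;> simp only [h, Set.indicator_of_mem, Set.indicator_of_notMem,
          not_false_eq_true] <;> constructor <;> linarith

/-- Boundedness alone is not enough on a strip of infinite measure; the decay in `x` comes from the
diagonal case `u = v` of the integral over `y`. -/
lemma memLp_gumbelKernel (u : ℝ) : MemLp (gumbelKernel u) 2 volume := by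
  have hm := measurable_gumbelKernel u
  rw [memLp_two_iff_integrable_sq hm.aestronglyMeasurable, Measure.volume_eq_prod,
    integrable_prod_iff (hm.pow_const 2).aestronglyMeasurable]
  constructor
  · refine ae_of_all _ fun x ↦ Integrable.of_bound (C := 1) ?_ (ae_of_all _ fun y ↦ ?_)
    · exact ((hm.comp measurable_prodMk_left).pow_const 2).aestronglyMeasurable
    · rw [norm_pow]
      exact pow_le_one₀ (norm_nonneg _) (abs_gumbelKernel_le u _)
  · refine (integrable_min_gumbelCDF_sub_mul u u).congr (ae_of_all _ fun x ↦ ?_)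
    dsimp only
    rw [← integral_gumbelKernel_mul_snd]
    refine integral_congr_ae (ae_of_all _ fun y ↦ ?_)
    simp [sq]

lemma integral_gumbelKernel_mul (u v : ℝ) :
    ∫ p, gumbelKernel u p * gumbelKernel v p = Real.log (1 + Real.exp (-|u - v|)) := by
  have hint : Integrable (fun p ↦ gumbelKernel u p * gumbelKernel v p) volume :=
    (memLp_gumbelKernel u).integrable_mul (memLp_gumbelKernel v)
  rw [Measure.volume_eq_prod, integral_prod _ hint]
  simp_rw [integral_gumbelKernel_mul_snd]
  exact integral_min_gumbelCDF_sub_mul u v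

/-! ### Gaussian laws and moments -/

section GaussianLaws

variable {Ω : Type*} [MeasurableSpace Ω] {P : Measure Ω}

/-- The law of a Gaussian process is determined by its mean and its covariance function. -/
lemma IsGaussianProcess.identDistrib_of_covariance_eq {T : Type*} {X Y : T → Ω → ℝ}
    (hX : IsGaussianProcess X P) (hY : IsGaussianProcess Y P)
    (hmean : ∀ t, ∫ ω, X t ω ∂P = ∫ ω, Y t ω ∂P)
    (hcov : ∀ s t, cov[X s, X t; P] = cov[Y s, Y t; P]) (I : Finset T) :
    IdentDistrib (fun ω (t : I) ↦ X t ω) (fun ω (t : I) ↦ Y t ω) P P := by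
  classical
  have := hX.isProbabilityMeasure
  have hX2 : ∀ t, MemLp (X t) 2 P := fun t ↦ (hX.hasGaussianLaw_eval t).memLp_two
  have hY2 : ∀ t, MemLp (Y t) 2 P := fun t ↦ (hY.hasGaussianLaw_eval t).memLp_two
  have gX : HasGaussianLaw (fun ω (t : I) ↦ X t ω) P := hX.hasGaussianLaw I
  have gY : HasGaussianLaw (fun ω (t : I) ↦ Y t ω) P := hY.hasGaussianLaw I
  refine ⟨gX.aemeasurable, gY.aemeasurable, ?_⟩
  have := Measure.isProbabilityMeasure_map gX.aemeasurable
  have := Measure.isProbabilityMeasure_map gY.aemeasurable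
  -- The characteristic function at `L` depends only on the mean and variance of `L` applied to the
  -- vector, which are determined by the means and covariances of the coordinates.
  refine Measure.ext_of_charFunDual (funext fun L ↦ ?_)
  have hL : ∀ Z : T → Ω → ℝ, (fun ω ↦ L fun t : I ↦ Z t ω)
      = fun ω ↦ ∑ i : I, L (Pi.single i 1) * Z i ω := fun Z ↦
    funext fun ω ↦ L.apply_pi_eq_sum _
  have hm : ∀ Z : T → Ω → ℝ, (∀ t, MemLp (Z t) 2 P) → ∫ ω, L (fun t : I ↦ Z t ω) ∂P
      = ∑ i : I, L (Pi.single i 1) * ∫ ω, Z i ω ∂P := fun Z hZ ↦ by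
    have hZ' : ∀ i ∈ (Finset.univ : Finset I), Integrable (fun ω ↦ L (Pi.single i 1) * Z i ω) P :=
      fun i _ ↦ ((hZ i).integrable one_le_two).const_mul _
    rw [hL Z, integral_finsetSum _ hZ']
    simp_rw [integral_const_mul]
  have hv : ∀ Z : T → Ω → ℝ, (∀ t, MemLp (Z t) 2 P) → Var[fun ω ↦ L (fun t : I ↦ Z t ω); P]
      = ∑ i : I, ∑ j : I, L (Pi.single i 1) * (L (Pi.single j 1) * cov[Z i, Z j; P]) :=
    fun Z hZ ↦ by
      have hZ' : ∀ i ∈ (Finset.univ : Finset I), MemLp (fun ω ↦ L (Pi.single i 1) * Z i ω) 2 P :=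
        fun i _ ↦ (hZ i).const_mul _
      rw [hL Z, ← covariance_self (memLp_finsetSum _ hZ').1.aemeasurable,
        covariance_fun_sum_fun_sum' hZ' hZ']
      simp_rw [covariance_const_mul_left, covariance_const_mul_right]
  rw [gX.charFunDual_map_eq_fun L, gY.charFunDual_map_eq_fun L, hm X hX2, hm Y hY2, hv X hX2,
    hv Y hY2]
  simp_rw [hmean, hcov]

/-- The centered law of variance `v` is the image of the standard one under multiplication by `√v`.
-/
lemma lintegral_enorm_pow_gaussianReal (v : ℝ≥0) (q : ℕ) :
    ∫⁻ x, ‖x‖ₑ ^ (2 * q) ∂(gaussianReal 0 v)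
      = (∫⁻ x, ‖x‖ₑ ^ (2 * q) ∂(gaussianReal 0 1)) * (v : ℝ≥0∞) ^ q := by
  have h : (gaussianReal 0 1).map (√v * ·) = gaussianReal 0 v := by
    rw [gaussianReal_map_const_mul]
    congr 1
    · simp
    · ext; simp
  have hv : ‖√(v : ℝ)‖ₑ ^ (2 * q) = (v : ℝ≥0∞) ^ q := by
    rw [pow_mul, ← enorm_pow, Real.sq_sqrt v.coe_nonneg, Real.enorm_of_nonneg v.coe_nonneg,
      ENNReal.ofReal_coe_nnreal]
  rw [← h, lintegral_map (by fun_prop) (by fun_prop)]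
  simp_rw [enorm_mul, mul_pow, hv]
  rw [lintegral_const_mul _ (by fun_prop), mul_comm]

lemma lintegral_enorm_pow_gaussianReal_ne_top (v : ℝ≥0) (q : ℕ) :
    ∫⁻ x, ‖x‖ₑ ^ q ∂(gaussianReal 0 v) ≠ ∞ := by
  rcases eq_or_ne q 0 with rfl | hq
  · simp
  have h := memLp_id_gaussianReal (μ := 0) (v := v) q
  have h' := lintegral_rpow_enorm_lt_top_of_eLpNorm_lt_top (by simpa) (by simp) h.2
  simpa using h'.ne

lemma HasGaussianLaw.lintegral_enorm_pow {f : Ω → ℝ} (hf : HasGaussianLaw f P)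
    (hmean : ∫ ω, f ω ∂P = 0) (q : ℕ) :
    ∫⁻ ω, ‖f ω‖ₑ ^ (2 * q) ∂P
      = (∫⁻ x, ‖x‖ₑ ^ (2 * q) ∂(gaussianReal 0 1)) * ENNReal.ofReal Var[f; P] ^ q := by
  have h := hf.map_eq_gaussianReal
  rw [hmean] at h
  rw [ENNReal.ofReal, ← lintegral_enorm_pow_gaussianReal, ← h,
    lintegral_map' (by fun_prop) hf.aemeasurable]

end GaussianLaws

/-! ### Hölder continuity from dyadic increments -/

section DyadicApproximation

/-- The values at the time `u` of the step functions which interpolate `x` from the left at the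
dyadic points of level `n`. -/
noncomputable def dyadicStep (x : ℝ → ℝ) (n : ℕ) (u : ℝ) : ℝ := x (⌊2 ^ n * u⌋ / 2 ^ n)

/-- The increments of `x` between neighbouring dyadic points of level `n` in bounded intervals
decay like `r ^ n`. -/
def HasDyadicDecay (x : ℝ → ℝ) (r : ℝ) : Prop :=
  ∀ N : ℕ, ∃ C : ℝ, 0 ≤ C ∧ ∀ (n : ℕ) (k : ℤ), |k| ≤ N * 2 ^ n →
    |x ((k + 1) / 2 ^ n) - x (k / 2 ^ n)| ≤ C * r ^ n

variable {x : ℝ → ℝ} {r : ℝ}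

lemma abs_floor_le {N : ℕ} {u : ℝ} (hu : |u| ≤ N) (n : ℕ) :
    |⌊2 ^ n * u⌋| ≤ (N + 1 : ℕ) * 2 ^ n := by
  have h2 : (1 : ℝ) ≤ 2 ^ n := one_le_pow₀ one_le_two
  have h1 : |2 ^ n * u| ≤ 2 ^ n * N := by
    rw [abs_mul, abs_of_nonneg (by positivity)]; gcongr
  have h3 : |(⌊2 ^ n * u⌋ : ℝ)| ≤ (N + 1 : ℕ) * 2 ^ n := by
    have := abs_le.1 h1
    push_cast
    rw [abs_le]
    constructor
    · linarith [Int.lt_floor_add_one (2 ^ n * u)]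
    · linarith [Int.floor_le (2 ^ n * u)]
  exact_mod_cast h3

/-- In both comparisons the two rounded points coincide or are neighbours, at level `n + 1` in the
first and `n` in the second, so at most one dyadic increment occurs. Using the decay on the range `N
+ 1` leaves room for rounding down. -/
lemma HasDyadicDecay.dyadicStep_succ_sub_le (hr : 0 ≤ r) (hx : HasDyadicDecay x r) (N : ℕ) :
    ∃ C : ℝ, 0 ≤ C ∧ (∀ (n : ℕ) (u : ℝ), |u| ≤ N → |dyadicStep x n u - dyadicStep x (n + 1) u| ≤ C * r ^ n) ∧
      ∀ (n : ℕ) (u v : ℝ), |u| ≤ N → |v| ≤ N → |u - v| ≤ 1 / 2 ^ n →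
        |dyadicStep x n u - dyadicStep x n v| ≤ C * r ^ n := by
  obtain ⟨C, hC0, hC⟩ := hx (N + 1)
  refine ⟨C * r + C, by positivity, fun n u hu ↦ ?_, fun n u v hu hv huv ↦ ?_⟩
  · set j := ⌊2 ^ n * u⌋ with hj
    have hle : C * r ^ (n + 1) ≤ (C * r + C) * r ^ n := by
      rw [pow_succ]; nlinarith [mul_nonneg hC0 (pow_nonneg hr n)]
    have hj1 : (j : ℝ) ≤ 2 ^ n * u := Int.floor_le _
    have hj2 : 2 ^ n * u < j + 1 := Int.lt_floor_add_one _
    have hj0 : (j : ℝ) / 2 ^ n = ((2 * j : ℤ) : ℝ) / 2 ^ (n + 1) := by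
      push_cast; rw [pow_succ]; field_simp
    have hcase : ⌊2 ^ (n + 1) * u⌋ = 2 * j ∨ ⌊2 ^ (n + 1) * u⌋ = 2 * j + 1 := by
      have h1 : 2 * j ≤ ⌊2 ^ (n + 1) * u⌋ := by
        rw [Int.le_floor]; push_cast; rw [pow_succ]; linarith
      have h2 : ⌊2 ^ (n + 1) * u⌋ < 2 * j + 2 := by
        rw [Int.floor_lt]; push_cast; rw [pow_succ]; linarith
      omega
    unfold dyadicStep
    rw [← hj, hj0]
    rcases hcase with h | h <;> rw [h]
    · simp only [sub_self, abs_zero]; positivity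
    · rw [abs_sub_comm]
      push_cast
      have hb : |2 * j| ≤ (N + 1 : ℕ) * 2 ^ (n + 1) := by
        have := abs_floor_le hu n
        rw [abs_mul, pow_succ, abs_two]
        push_cast at this ⊢
        linarith
      have := hC (n + 1) (2 * j) hb
      push_cast at this
      exact this.trans hle
  · wlog h : u ≤ v generalizing u v
    · rw [abs_sub_comm]
      exact this v u hv hu (by rwa [abs_sub_comm]) (le_of_not_ge h)
    have h2 : (0 : ℝ) < 2 ^ n := by positivity
    have huv' : 2 ^ n * v ≤ 2 ^ n * u + 1 := by
      rw [abs_sub_comm, abs_of_nonneg (sub_nonneg.2 h), le_div_iff₀ h2] at huv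
      linarith
    set j := ⌊2 ^ n * u⌋ with hj
    have hcase : ⌊2 ^ n * v⌋ = j ∨ ⌊2 ^ n * v⌋ = j + 1 := by
      have h3 : j ≤ ⌊2 ^ n * v⌋ := Int.floor_le_floor (by gcongr)
      have h4 : ⌊2 ^ n * v⌋ < j + 2 := by
        rw [Int.floor_lt]; push_cast; linarith [Int.lt_floor_add_one (2 ^ n * u)]
      omega
    unfold dyadicStep
    rw [← hj]
    rcases hcase with h | h <;> rw [h]
    · simp only [sub_self, abs_zero]; positivity
    · rw [abs_sub_comm]
      push_cast
      refine (hC n j (abs_floor_le hu n)).trans ?_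
      gcongr
      linarith [mul_nonneg hC0 hr]

lemma HasDyadicDecay.exists_tendsto (hr : 0 ≤ r) (hr1 : r < 1) (hx : HasDyadicDecay x r)
    (u : ℝ) : ∃ l, Tendsto (fun n ↦ dyadicStep x n u) atTop (𝓝 l) := by
  obtain ⟨N, hN⟩ := exists_nat_ge |u|
  obtain ⟨C, hC0, hC, -⟩ := hx.dyadicStep_succ_sub_le hr N
  exact cauchySeq_tendsto_of_complete (cauchySeq_of_le_geometric r C hr1 fun n ↦ by
    rw [Real.dist_eq]; exact hC n u hN)

/-- The limit of the dyadic step functions is locally Hölder continuous. -/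
lemma HasDyadicDecay.exists_holderOnWith {α : ℝ≥0} (hα : 0 < α)
    (hx : HasDyadicDecay x ((1 / 2 : ℝ) ^ (α : ℝ))) {y : ℝ → ℝ}
    (hy : ∀ u, Tendsto (fun n ↦ dyadicStep x n u) atTop (𝓝 (y u))) (a b : ℝ) :
    ∃ C : ℝ≥0, HolderOnWith C α y (Set.Icc a b) := by
  set r : ℝ := (1 / 2 : ℝ) ^ (α : ℝ) with hr
  have hr0 : 0 < r := by positivity
  have hr1 : r < 1 := Real.rpow_lt_one (by norm_num) (by norm_num) (by exact_mod_cast hα)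
  have hrn : ∀ n : ℕ, r ^ n = ((1 / 2 : ℝ) ^ n) ^ (α : ℝ) := fun n ↦ by
    rw [hr, ← Real.rpow_natCast, ← Real.rpow_natCast, ← Real.rpow_mul (by norm_num),
      ← Real.rpow_mul (by norm_num), mul_comm]
  obtain ⟨N, hN⟩ := exists_nat_ge (max |a| |b|)
  have habs : ∀ u ∈ Set.Icc a b, |u| ≤ N := fun u hu ↦
    (abs_le_max_abs_abs hu.1 hu.2).trans hN
  obtain ⟨C, hC0, hC1, hC2⟩ := hx.dyadicStep_succ_sub_le hr0.le N
  set D : ℝ := C / (1 - r) with hD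
  have hD0 : 0 ≤ D := div_nonneg hC0 (by linarith)
  have hlim : ∀ (n : ℕ) (u : ℝ), |u| ≤ N → |dyadicStep x n u - y u| ≤ D * r ^ n := fun n u hu ↦ by
    have := dist_le_of_le_geometric_of_tendsto r C hr1
      (fun n ↦ by rw [Real.dist_eq]; exact hC1 n u hu) (hy u) n
    rw [Real.dist_eq] at this
    rwa [hD, div_mul_eq_mul_div]
  -- At level `0` the step function takes only values of `x` at integers, so `B` bounds it; this
  -- handles points more than `1` apart.
  set B : ℝ := ∑ k ∈ Finset.Icc (-(N + 1 : ℕ) : ℤ) (N + 1 : ℕ), |x k| with hB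
  have hB0 : 0 ≤ B := Finset.sum_nonneg fun k _ ↦ abs_nonneg _
  have hbound : ∀ u : ℝ, |u| ≤ N → |dyadicStep x 0 u| ≤ B := fun u hu ↦ by
    have hk := abs_le.1 (abs_floor_le hu 0)
    simp only [pow_zero, one_mul, mul_one] at hk
    simp only [dyadicStep, pow_zero, one_mul, div_one]
    exact Finset.single_le_sum (f := fun k : ℤ ↦ |x k|) (fun k _ ↦ abs_nonneg _)
      (Finset.mem_Icc.2 hk)
  -- The first summand serves `|u - v| ≤ 1`, the second `|u - v| > 1`.
  set K : ℝ := (C + 2 * D) / r + (2 * B + 2 * D) with hK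
  have hK0 : 0 ≤ K := by positivity
  have key : ∀ u ∈ Set.Icc a b, ∀ v ∈ Set.Icc a b, |y u - y v| ≤ K * |u - v| ^ (α : ℝ) := by
    intro u hu v hv
    have hu' := habs u hu
    have hv' := habs v hv
    have htri : ∀ n, |y u - y v| ≤ |dyadicStep x n u - dyadicStep x n v| + 2 * D * r ^ n :=
      fun n ↦ by
        have h1 := abs_le.1 (hlim n u hu')
        have h2 := abs_le.1 (hlim n v hv')
        have h3 := abs_le.1 (le_refl |dyadicStep x n u - dyadicStep x n v|)
        rw [abs_le]
        constructor <;> linarith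
    rcases eq_or_ne u v with rfl | huv
    · simp only [sub_self, abs_zero]; positivity
    have hpos : 0 < |u - v| := abs_pos.2 (sub_ne_zero.2 huv)
    rcases le_or_gt |u - v| 1 with hle | hgt
    -- The level with `(1/2) ^ (n + 1) < |u - v| ≤ (1/2) ^ n`: the upper bound makes the rounded
    -- points neighbours, the lower one gives `r ^ (n + 1) ≤ |u - v| ^ α`.
    · obtain ⟨n, hn1, hn2⟩ := exists_nat_pow_near_of_lt_one hpos hle
        (by norm_num : (0 : ℝ) < 1 / 2) (by norm_num)
      have h1 := hC2 n u v hu' hv' (by simpa using hn2)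
      have h2 : r ^ n ≤ |u - v| ^ (α : ℝ) / r := by
        rw [le_div_iff₀ hr0, ← pow_succ, hrn]
        exact Real.rpow_le_rpow (by positivity) hn1.le α.coe_nonneg
      calc |y u - y v| ≤ (C + 2 * D) * r ^ n := by linarith [htri n]
        _ ≤ (C + 2 * D) * (|u - v| ^ (α : ℝ) / r) := by gcongr
        _ = (C + 2 * D) / r * |u - v| ^ (α : ℝ) := by ring
        _ ≤ K * |u - v| ^ (α : ℝ) := by
          gcongr
          rw [hK]
          linarith
    · have h1 : 1 ≤ |u - v| ^ (α : ℝ) := Real.one_le_rpow hgt.le α.coe_nonneg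
      have h2 := htri 0
      have h3 := abs_le.1 (hbound u hu')
      have h4 := abs_le.1 (hbound v hv')
      have h5 : |dyadicStep x 0 u - dyadicStep x 0 v| ≤ 2 * B := by
        rw [abs_le]; constructor <;> linarith
      calc |y u - y v| ≤ 2 * B + 2 * D := by rw [pow_zero] at h2; linarith
        _ ≤ K := by rw [hK]; linarith [show 0 ≤ (C + 2 * D) / r by positivity]
        _ ≤ K * |u - v| ^ (α : ℝ) := le_mul_of_one_le_right hK0 h1
  refine ⟨K.toNNReal, fun u hu v hv ↦ ?_⟩
  change edist (y u) (y v) ≤ ENNReal.ofReal K * edist u v ^ (α : ℝ)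
  rw [edist_dist, edist_dist, ENNReal.ofReal_rpow_of_nonneg dist_nonneg α.coe_nonneg,
    ← ENNReal.ofReal_mul hK0, Real.dist_eq, Real.dist_eq]
  exact ENNReal.ofReal_le_ofReal (key u hu v hv)

end DyadicApproximation

/-! ### The Kolmogorov–Chentsov theorem -/

section KolmogorovChentsov

variable {Ω : Type*} [MeasurableSpace Ω] {P : Measure Ω} {X : ℝ → Ω → ℝ}

/-- The weighted sum of the `2 (m + 2)`-th powers of the dyadic increments of `X` in `[-N, N]`. -/
noncomputable def dyadicEnergy (X : ℝ → Ω → ℝ) (m N : ℕ) (ω : Ω) : ℝ≥0∞ :=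
  ∑' n : ℕ, ∑ k ∈ Finset.Icc (-(N * 2 ^ n) : ℤ) (N * 2 ^ n),
    2 ^ (n * m) * ‖X ((k + 1) / 2 ^ n) ω - X (k / 2 ^ n) ω‖ₑ ^ (2 * (m + 2))

lemma measurable_dyadicEnergy (hX : ∀ u, Measurable (X u)) (m N : ℕ) :
    Measurable (dyadicEnergy X m N) :=
  Measurable.tsum fun _ ↦ Finset.measurable_sum _ fun _ _ ↦
    ((((hX _).sub (hX _)).enorm).pow_const _).const_mul _

/-- A moment at level `n` is at most `K * 2 ^ (-n(m + 2))`. The weight `2 ^ (nm)` leaves `K * 2 ^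
(-2n)`, and there are at most `(2N + 1) * 2 ^ n` terms, so a geometric series remains. -/
lemma lintegral_dyadicEnergy_ne_top (hX : ∀ u, Measurable (X u)) {m N : ℕ} {K : ℝ≥0∞}
    (hK : K ≠ ∞) (h : ∀ u v, ∫⁻ ω, ‖X u ω - X v ω‖ₑ ^ (2 * (m + 2)) ∂P
      ≤ K * ENNReal.ofReal |u - v| ^ (m + 2)) :
    ∫⁻ ω, dyadicEnergy X m N ω ∂P ≠ ∞ := by
  have hmeas : ∀ u v, Measurable fun ω ↦ ‖X u ω - X v ω‖ₑ ^ (2 * (m + 2)) := fun u v ↦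
    (((hX u).sub (hX v)).enorm).pow_const _
  have hterm : ∀ (n : ℕ) (k : ℤ), ∫⁻ ω, 2 ^ (n * m)
      * ‖X ((k + 1) / 2 ^ n) ω - X (k / 2 ^ n) ω‖ₑ ^ (2 * (m + 2)) ∂P
      ≤ K * (2⁻¹ ^ n * 2⁻¹ ^ n) := fun n k ↦ by
    rw [lintegral_const_mul _ (hmeas _ _)]
    have habs : ENNReal.ofReal |((k : ℝ) + 1) / 2 ^ n - k / 2 ^ n| = 2⁻¹ ^ n := by
      have : ((k : ℝ) + 1) / 2 ^ n - k / 2 ^ n = 2⁻¹ ^ n := by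
        rw [← sub_div, inv_pow]; simp
      rw [this, abs_of_nonneg (by positivity), ENNReal.ofReal_pow (by positivity),
        ENNReal.ofReal_inv_of_pos two_pos, ENNReal.ofReal_ofNat]
    have hle := h (((k : ℝ) + 1) / 2 ^ n) (k / 2 ^ n)
    rw [habs] at hle
    calc (2 : ℝ≥0∞) ^ (n * m) * _ ≤ 2 ^ (n * m) * (K * (2⁻¹ ^ n) ^ (m + 2)) := by gcongr
      _ = K * ((2 ^ (n * m) * 2⁻¹ ^ (n * m)) * (2⁻¹ ^ n * 2⁻¹ ^ n)) := by
        rw [pow_add, ← pow_mul]; ring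
      _ = K * (2⁻¹ ^ n * 2⁻¹ ^ n) := by
        rw [← mul_pow, ENNReal.mul_inv_cancel two_ne_zero (by simp), one_pow, one_mul]
  have hsum : ∀ n : ℕ, ∫⁻ ω, ∑ k ∈ Finset.Icc (-(N * 2 ^ n) : ℤ) (N * 2 ^ n),
      2 ^ (n * m) * ‖X ((k + 1) / 2 ^ n) ω - X (k / 2 ^ n) ω‖ₑ ^ (2 * (m + 2)) ∂P
      ≤ ((2 * N + 1 : ℕ) * K) * 2⁻¹ ^ n := fun n ↦ by
    rw [lintegral_finsetSum _ fun k _ ↦ (hmeas _ _).const_mul _]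
    refine (Finset.sum_le_sum fun k _ ↦ hterm n k).trans ?_
    rw [Finset.sum_const, nsmul_eq_mul, Int.card_Icc]
    have hcard : ((N * 2 ^ n + 1 - -(N * 2 ^ n) : ℤ).toNat) ≤ (2 * N + 1) * 2 ^ n := by
      have : (1 : ℤ) ≤ 2 ^ n := one_le_pow₀ (by norm_num)
      rw [Int.toNat_le]
      push_cast
      linarith
    calc (((N * 2 ^ n + 1 - -(N * 2 ^ n) : ℤ).toNat : ℕ) : ℝ≥0∞) * (K * (2⁻¹ ^ n * 2⁻¹ ^ n))
        ≤ (((2 * N + 1) * 2 ^ n : ℕ) : ℝ≥0∞) * (K * (2⁻¹ ^ n * 2⁻¹ ^ n)) := by gcongr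
      _ = ((2 * N + 1 : ℕ) * K) * ((2 ^ n * 2⁻¹ ^ n) * 2⁻¹ ^ n) := by push_cast; ring
      _ = ((2 * N + 1 : ℕ) * K) * 2⁻¹ ^ n := by
        rw [← mul_pow 2, ENNReal.mul_inv_cancel two_ne_zero (by simp), one_pow, one_mul]
  unfold dyadicEnergy
  rw [lintegral_tsum fun n ↦ (Finset.measurable_sum _ fun _ _ ↦
    (hmeas _ _).const_mul _).aemeasurable]
  refine ((ENNReal.tsum_le_tsum hsum).trans_lt ?_).ne
  rw [ENNReal.tsum_mul_left, ENNReal.tsum_geometric, ENNReal.one_sub_inv_two, inv_inv]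
  exact ENNReal.mul_lt_top (ENNReal.mul_lt_top (ENNReal.natCast_lt_top _) hK.lt_top) (by simp)

omit [MeasurableSpace Ω] in
-- A single term is bounded by the whole sum. Passing from `S` to `1 + S ≥ 1` allows `S ≤ (1 + S) ^
-- (2 * (m + 2))`, which avoids taking roots.
lemma abs_sub_le_of_dyadicEnergy {m N : ℕ} {ω : Ω} (h : dyadicEnergy X m N ω ≠ ∞) {r : ℝ}
    (hr : 0 ≤ r) (hrm : 2⁻¹ ^ m ≤ r ^ (2 * (m + 2))) {n : ℕ} {k : ℤ}
    (hk : |k| ≤ N * 2 ^ n) :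
    |X ((k + 1) / 2 ^ n) ω - X (k / 2 ^ n) ω| ≤ (1 + (dyadicEnergy X m N ω).toReal) * r ^ n := by
  set d := |X ((k + 1) / 2 ^ n) ω - X (k / 2 ^ n) ω| with hd
  set S := (dyadicEnergy X m N ω).toReal with hS
  have hS0 : 0 ≤ S := ENNReal.toReal_nonneg
  have hterm : 2 ^ (n * m) * ‖X ((k + 1) / 2 ^ n) ω - X (k / 2 ^ n) ω‖ₑ ^ (2 * (m + 2))
      ≤ dyadicEnergy X m N ω :=
    (Finset.single_le_sum (f := fun k : ℤ ↦ (2 : ℝ≥0∞) ^ (n * m)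
        * ‖X ((k + 1) / 2 ^ n) ω - X (k / 2 ^ n) ω‖ₑ ^ (2 * (m + 2)))
      (fun _ _ ↦ zero_le) (Finset.mem_Icc.2 (abs_le.1 hk))).trans (ENNReal.le_tsum n)
  have hreal : 2 ^ (n * m) * d ^ (2 * (m + 2)) ≤ S := by
    have := ENNReal.toReal_mono h hterm
    simpa [ENNReal.toReal_mul, ENNReal.toReal_pow, Real.norm_eq_abs] using this
  refine (pow_le_pow_iff_left₀ (abs_nonneg _) (by positivity)
    (show 2 * (m + 2) ≠ 0 by omega)).1 ?_
  calc d ^ (2 * (m + 2)) = (2 ^ (n * m) * d ^ (2 * (m + 2))) * (2⁻¹ ^ m) ^ n := by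
        rw [← pow_mul, mul_comm m n, mul_right_comm, ← mul_pow]; norm_num
    _ ≤ S * (r ^ (2 * (m + 2))) ^ n := by gcongr
    _ ≤ (1 + S) ^ (2 * (m + 2)) * (r ^ (2 * (m + 2))) ^ n := by
        gcongr
        exact (by linarith : S ≤ 1 + S).trans (le_self_pow₀ (by linarith) (by omega))
    _ = ((1 + S) * r ^ n) ^ (2 * (m + 2)) := by rw [mul_pow]; ring

lemma half_pow_le_rpow {α : ℝ} {m : ℕ} (h : 2 * (m + 2) * α ≤ m) :
    (2⁻¹ : ℝ) ^ m ≤ ((1 / 2 : ℝ) ^ α) ^ (2 * (m + 2)) := by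
  rw [← Real.rpow_natCast, ← Real.rpow_natCast, ← Real.rpow_mul (by norm_num), one_div]
  refine Real.rpow_le_rpow_of_exponent_ge (by norm_num) (by norm_num) ?_
  push_cast
  linarith

/-- The exponent `m / (2(m + 2))` reached with moments of order `2(m + 2)` tends to `1/2`; solving
for `m` gives the threshold below. -/
lemma exists_nat_mul_le_of_lt_half {α : ℝ} (h : α < 1 / 2) : ∃ m : ℕ, 2 * (m + 2) * α ≤ m := by
  obtain ⟨m, hm⟩ := exists_nat_ge (4 * α / (1 - 2 * α))
  rw [div_le_iff₀ (by linarith)] at hm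
  exact ⟨m, by linarith⟩

lemma ae_tendsto_unique_of_tendsto_eLpNorm {f : ℕ → Ω → ℝ} {g y : Ω → ℝ}
    (hf : ∀ n, AEStronglyMeasurable (f n) P) (hg : AEStronglyMeasurable g P)
    (h : Tendsto (fun n ↦ eLpNorm (f n - g) 2 P) atTop (𝓝 0))
    (hy : ∀ᵐ ω ∂P, Tendsto (fun n ↦ f n ω) atTop (𝓝 (y ω))) : y =ᵐ[P] g := by
  obtain ⟨ns, hns, hae⟩ :=
    (tendstoInMeasure_of_tendsto_eLpNorm two_ne_zero hf hg h).exists_seq_tendsto_ae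
  filter_upwards [hae, hy] with ω h1 h2
  exact tendsto_nhds_unique (h2.comp hns.tendsto_atTop) h1

lemma tendsto_floor_mul_two_pow_div (u : ℝ) :
    Tendsto (fun n : ℕ ↦ (⌊(2 : ℝ) ^ n * u⌋ : ℝ) / 2 ^ n) atTop (𝓝 u) := by
  have hb : ∀ n : ℕ, |(⌊(2 : ℝ) ^ n * u⌋ : ℝ) / 2 ^ n - u| ≤ (1 / 2) ^ n := fun n ↦ by
    have h2 : (0 : ℝ) < 2 ^ n := by positivity
    have h3 : (⌊(2 : ℝ) ^ n * u⌋ : ℝ) / 2 ^ n - u = (⌊(2 : ℝ) ^ n * u⌋ - 2 ^ n * u) / 2 ^ n := by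
      field_simp
    rw [h3, abs_div, abs_of_pos h2, one_div_pow]
    gcongr
    rw [abs_le]
    constructor
    · linarith [Int.lt_floor_add_one ((2 : ℝ) ^ n * u)]
    · linarith [Int.floor_le ((2 : ℝ) ^ n * u)]
  rw [tendsto_iff_norm_sub_tendsto_zero]
  exact squeeze_zero (fun _ ↦ norm_nonneg _) hb
    (tendsto_pow_atTop_nhds_zero_of_lt_one (by norm_num) (by norm_num))

/-- The Kolmogorov–Chentsov theorem for processes whose increments satisfy the Gaussian moment
bounds `E |X u - X v| ^ (2 q) ≤ K |u - v| ^ q`. -/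
theorem exists_version_holder_of_moment_bounds (hX : ∀ u, AEMeasurable (X u) P)
    (h : ∀ q : ℕ, ∃ K : ℝ≥0∞, K ≠ ∞ ∧ ∀ u v, ∫⁻ ω, ‖X u ω - X v ω‖ₑ ^ (2 * q) ∂P
      ≤ K * ENNReal.ofReal |u - v| ^ q) :
    ∃ Y : ℝ → Ω → ℝ, (∀ u, Measurable (Y u)) ∧ (∀ u, Y u =ᵐ[P] X u) ∧
      ∀ α : ℝ≥0, 0 < α → α < 1 / 2 → ∀ ω : Ω, ∀ a b : ℝ,
        ∃ C : ℝ≥0, HolderOnWith C α (fun u ↦ Y u ω) (Set.Icc a b) := by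
  wlog hm : ∀ u, Measurable (X u) generalizing X
  · obtain ⟨Y, hY1, hY2, hY3⟩ := this (X := fun u ↦ (hX u).mk (X u))
      (fun u ↦ (hX u).measurable_mk.aemeasurable)
      (fun q ↦ by
        obtain ⟨K, hK, hle⟩ := h q
        refine ⟨K, hK, fun u v ↦ ?_⟩
        rw [lintegral_congr_ae (g := fun ω ↦ ‖X u ω - X v ω‖ₑ ^ (2 * q))]
        · exact hle u v
        · filter_upwards [(hX u).ae_eq_mk, (hX v).ae_eq_mk] with ω h1 h2
          rw [h1, h2])
      (fun u ↦ (hX u).measurable_mk)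
    exact ⟨Y, hY1, fun u ↦ (hY2 u).trans (hX u).ae_eq_mk.symm, hY3⟩
  set G : Set Ω := {ω | ∀ m N : ℕ, dyadicEnergy X m N ω ≠ ∞} with hG
  have hGm : MeasurableSet G := by
    simp only [hG, Set.ofPred_forall]
    exact MeasurableSet.iInter fun m ↦ MeasurableSet.iInter fun N ↦
      (measurable_dyadicEnergy hm m N (measurableSet_singleton ∞)).compl
  have hGae : ∀ᵐ ω ∂P, ω ∈ G := by
    simp only [hG, Set.mem_ofPred_eq, ae_all_iff]
    intro m N
    obtain ⟨K, hK, hle⟩ := h (m + 2)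
    filter_upwards [ae_lt_top (measurable_dyadicEnergy hm m N)
      (lintegral_dyadicEnergy_ne_top hm hK hle)] with ω hω using hω.ne
  -- Setting the paths to zero off the almost sure event `G` makes every path regular, not just
  -- almost every one.
  set x : Ω → ℝ → ℝ := fun ω u ↦ G.indicator (X u) ω with hx
  have hdecay : ∀ ω, ∀ α : ℝ, α < 1 / 2 → HasDyadicDecay (x ω) ((1 / 2 : ℝ) ^ α) := by
    intro ω α hα N
    by_cases hω : ω ∈ G
    · obtain ⟨m, hαm⟩ := exists_nat_mul_le_of_lt_half hα
      refine ⟨1 + (dyadicEnergy X m N ω).toReal, by positivity, fun n k hk ↦ ?_⟩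
      simp only [hx, Set.indicator_of_mem hω]
      exact abs_sub_le_of_dyadicEnergy (hω m N) (by positivity) (half_pow_le_rpow hαm) hk
    · refine ⟨0, le_rfl, fun n k _ ↦ ?_⟩
      simp [hx, Set.indicator_of_notMem hω]
  -- Any exponent in `(0, 1/2)` would do in place of `1/4`. The limit does not depend on it, so one
  -- version serves all Hölder exponents.
  have hlim : ∀ u ω, ∃ l, Tendsto (fun n ↦ dyadicStep (x ω) n u) atTop (𝓝 l) := fun u ω ↦
    (hdecay ω (1 / 4) (by norm_num)).exists_tendsto (by positivity)
      (Real.rpow_lt_one (by norm_num) (by norm_num) (by norm_num)) u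
  choose Y hY using hlim
  refine ⟨Y, fun u ↦ ?_, fun u ↦ ?_, fun α hα0 hα ω a b ↦ ?_⟩
  · exact measurable_of_tendsto_metrizable
      (f := fun n ω ↦ dyadicStep (x ω) n u) (fun n ↦ (hm _).indicator hGm)
      (tendsto_pi_nhds.2 fun ω ↦ hY u ω)
  · refine ae_tendsto_unique_of_tendsto_eLpNorm
      (f := fun n ↦ X (⌊(2 : ℝ) ^ n * u⌋ / 2 ^ n)) (fun n ↦ (hm _).aestronglyMeasurable)
      (hm u).aestronglyMeasurable ?_ ?_
    -- The case `q = 1` is continuity in `L²`, which identifies the pointwise dyadic limit with `X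
    -- u` almost surely.
    · obtain ⟨K, hK, hle⟩ := h 1
      have hb : ∀ n : ℕ, eLpNorm (X (⌊(2 : ℝ) ^ n * u⌋ / 2 ^ n) - X u) 2 P
          ≤ (K * ENNReal.ofReal |⌊(2 : ℝ) ^ n * u⌋ / 2 ^ n - u|) ^ (1 / 2 : ℝ) := fun n ↦ by
        rw [eLpNorm_eq_lintegral_rpow_enorm_toReal two_ne_zero (by simp)]
        simp only [ENNReal.toReal_ofNat]
        gcongr
        simpa using hle (⌊(2 : ℝ) ^ n * u⌋ / 2 ^ n) u
      refine tendsto_of_tendsto_of_tendsto_of_le_of_le tendsto_const_nhds ?_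
        (fun _ ↦ zero_le) hb
      have h1 : Tendsto (fun n : ℕ ↦ |(⌊(2 : ℝ) ^ n * u⌋ : ℝ) / 2 ^ n - u|) atTop (𝓝 0) := by
        simpa using ((tendsto_floor_mul_two_pow_div u).sub_const u).abs
      have h2 := ENNReal.Tendsto.const_mul (ENNReal.tendsto_ofReal h1) (.inr hK)
      simpa using h2.ennrpow_const (1 / 2 : ℝ)
    · filter_upwards [hGae] with ω hω
      simpa [dyadicStep, hx, Set.indicator_of_mem hω] using hY u ω
  · have hα' : (α : ℝ) < 1 / 2 := by exact_mod_cast hα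
    exact (hdecay ω α hα').exists_holderOnWith hα0 (fun u ↦ hY u ω) a b

/-- A centered Gaussian process whose increments have a variance of at most linear growth has a
version that is locally Hölder continuous of every order below `1 / 2`. -/
theorem IsGaussianProcess.exists_version_holder (hX : IsGaussianProcess X P)
    (hmean : ∀ u, ∫ ω, X u ω ∂P = 0) {c : ℝ} (hvar : ∀ u v, Var[X u - X v; P] ≤ c * |u - v|) :
    ∃ Y : ℝ → Ω → ℝ, (∀ u, Measurable (Y u)) ∧ (∀ u, Y u =ᵐ[P] X u) ∧
      ∀ α : ℝ≥0, 0 < α → α < 1 / 2 → ∀ ω : Ω, ∀ a b : ℝ,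
        ∃ C : ℝ≥0, HolderOnWith C α (fun u ↦ Y u ω) (Set.Icc a b) := by
  refine exists_version_holder_of_moment_bounds hX.aemeasurable fun q ↦
    ⟨(∫⁻ x, ‖x‖ₑ ^ (2 * q) ∂(gaussianReal 0 1)) * ENNReal.ofReal c ^ q,
      ENNReal.mul_ne_top (lintegral_enorm_pow_gaussianReal_ne_top _ _) (by simp), fun u v ↦ ?_⟩
  have hint : ∀ u, Integrable (X u) P := fun u ↦ (hX.hasGaussianLaw_eval u).integrable
  have hm : ∫ ω, (X u - X v) ω ∂P = 0 := by
    simp only [Pi.sub_apply]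
    rw [integral_sub (hint u) (hint v), hmean, hmean, sub_zero]
  have := HasGaussianLaw.lintegral_enorm_pow (hX.hasGaussianLaw_sub (s := u) (t := v)) hm q
  simp only [Pi.sub_apply] at this
  rw [this, mul_assoc, ← mul_pow, ← ENNReal.ofReal_mul' (abs_nonneg _)]
  gcongr
  exact hvar u v

end KolmogorovChentsov

/-! ### The increments of `Z` and the conclusion -/

/-- After exponentiating, this is `2 ≤ exp t + 1`. -/
lemma log_two_sub_log_one_add_exp_neg_le {t : ℝ} (ht : 0 ≤ t) :
    Real.log 2 - Real.log (1 + Real.exp (-t)) ≤ t := by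
  rw [← Real.log_div (by norm_num) (by positivity), Real.log_le_iff_le_exp (by positivity),
    div_le_iff₀ (by positivity), mul_add, ← Real.exp_add, add_neg_cancel, Real.exp_zero]
  linarith [Real.one_le_exp ht]

theorem theorem1p3 {Ω : Type*} [MeasurableSpace Ω] (P : Measure Ω) [IsProbabilityMeasure P]
    (W : Set (ℝ × Set.Icc (0 : ℝ) 1) → Ω → ℝ)
    (hW : IsWhiteNoise W (volume : Measure (ℝ × Set.Icc (0 : ℝ) 1)) P) :
    -- the stochastic integrals defining `Z(u)` exist
    (∀ u : ℝ, IsWhiteNoiseIntegral W volume P (gumbelKernel u)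
      (whiteNoiseIntegral W volume P (gumbelKernel u))) ∧
    -- `Z` is a stationary centered Gaussian process
    IsGaussianProcess (gumbelProcess W P) P ∧
    IsStationaryProcess (gumbelProcess W P) P ∧
    (∀ u : ℝ, ∫ ω, gumbelProcess W P u ω ∂P = 0) ∧
    -- with the stated covariance function
    (∀ u v : ℝ, cov[gumbelProcess W P u, gumbelProcess W P v; P]
      = Real.log (1 + Real.exp (-|u - v|)) / Real.log 2) ∧
    -- and it has a version with (locally) Hölder continuous paths of all exponents below `1/2`
    (∃ Y : ℝ → Ω → ℝ, (∀ u, Measurable (Y u)) ∧ (∀ u, Y u =ᵐ[P] gumbelProcess W P u) ∧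
      ∀ α : ℝ≥0, 0 < α → α < 1 / 2 → ∀ ω : Ω, ∀ a b : ℝ,
        ∃ C : ℝ≥0, HolderOnWith C α (fun u ↦ Y u ω) (Set.Icc a b)) := by
  have hI : ∀ u : ℝ, IsWhiteNoiseIntegral W volume P (gumbelKernel u)
      (whiteNoiseIntegral W volume P (gumbelKernel u)) := fun u ↦
    hW.isWhiteNoiseIntegral (memLp_gumbelKernel u)
  have hlog : 0 < Real.log 2 := Real.log_pos one_lt_two
  have hG : IsGaussianProcess (gumbelProcess W P) P :=
    (hW.isGaussianProcess_integral hI).smul fun _ ↦ 1 / √(Real.log 2)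
  have hmean : ∀ u : ℝ, ∫ ω, gumbelProcess W P u ω ∂P = 0 := fun u ↦ by
    simp only [gumbelProcess]
    rw [integral_const_mul, (hI u).integral_eq_zero hW, mul_zero]
  have hcov : ∀ u v : ℝ, cov[gumbelProcess W P u, gumbelProcess W P v; P]
      = Real.log (1 + Real.exp (-|u - v|)) / Real.log 2 := fun u v ↦ by
    unfold gumbelProcess
    rw [covariance_const_mul_left, covariance_const_mul_right, (hI u).covariance_eq (hI v) hW,
      integral_gumbelKernel_mul, ← mul_assoc, one_div, ← mul_inv, Real.mul_self_sqrt hlog.le,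
      inv_mul_eq_div]
  refine ⟨hI, hG, fun h I ↦ ?_, hmean, hcov, ?_⟩
  · refine IsGaussianProcess.identDistrib_of_covariance_eq
      (X := fun t ↦ gumbelProcess W P (t + h)) (hG.comp_right (· + h)) hG
      (fun t ↦ ?_) (fun s t ↦ ?_) I
    · rw [hmean, hmean]
    · rw [hcov, hcov, add_sub_add_right_eq_sub]
  -- The variance of the increment is `2 * (log 2 - log (1 + exp (-|u - v|))) / log 2`, whence the
  -- constant.
  · refine IsGaussianProcess.exists_version_holder hG hmean (c := 2 / Real.log 2) fun u v ↦ ?_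
    have hL : ∀ u, MemLp (gumbelProcess W P u) 2 P := fun u ↦
      (hG.hasGaussianLaw_eval u).memLp_two
    rw [variance_sub (hL u) (hL v), ← covariance_self (hL u).1.aemeasurable,
      ← covariance_self (hL v).1.aemeasurable, hcov, hcov, hcov]
    have hle := log_two_sub_log_one_add_exp_neg_le (abs_nonneg (u - v))
    simp only [sub_self, abs_zero, neg_zero, Real.exp_zero, one_add_one_eq_two]
    rw [div_self hlog.ne', div_mul_eq_mul_div, le_div_iff₀ hlog]
    field_simp
    linarith
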